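/- Let $\delta\in(1/2,1]$. Consider all probability spaces $(\Omega,\mathcal F,\mathbb P)$ and all pairs of real random variables $(X,Y)$ on them for which there are an event $A\in\mathcal F$ and independent sub-$\sigma$-fields $\mathcal G,\mathcal H\subset\mathcal F$ with $X=\mathbb E(\mathbf 1_A\mid\mathcal G)$ and $Y=\mathbb E(\mathbf 1_A\mid\mathcal H)$ almost surely. Then $$\sup\ \mathbb P(|X-Y|\ge\delta)=2\delta(1-\delta),$$ where the supremum is taken over all such probability spaces and pairs. The supremum has the same value $2\delta(1-\delta)$ if it is taken instead over all pairs $(X,Y)$ with $X=\mathbb E(\mathbf 1_A\mid\mathcal G)$ and $Y=\mathbb E(\mathbf 1_A\mid\mathcal H)$ almost surely, for some event $A\in\mathcal F$ and some (not necessarily independent) sub-$\sigma$-fields $\mathcal G,\mathcal H\subset\mathcal F$, such that the random variables $X$ and $Y$ are independent. -/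

import Mathlib

open MeasureTheory ProbabilityTheory

universe u

/-- `(X, Y)` is a random vector on the probability space `(Ω, mΩ, μ)` with
`X = E(1_A | 𝒢)` and `Y = E(1_A | ℋ)` almost surely, for some event `A`, where `𝒢` and `ℋ` are
sub-σ-fields of `mΩ`. -/
structure IsCoherentVia {Ω : Type u} {mΩ : MeasurableSpace Ω} (μ : Measure[mΩ] Ω)
    (𝒢 ℋ : MeasurableSpace Ω) (X Y : Ω → ℝ) : Prop where
  measurable_fst : Measurable[mΩ] X
  measurable_snd : Measurable[mΩ] Y
  fst_le : 𝒢 ≤ mΩ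
  snd_le : ℋ ≤ mΩ
  exists_event : ∃ A : Set Ω, MeasurableSet[mΩ] A ∧
    X =ᵐ[μ] μ[A.indicator (fun _ => (1 : ℝ)) | 𝒢] ∧
    Y =ᵐ[μ] μ[A.indicator (fun _ => (1 : ℝ)) | ℋ]

/-- `(X, Y)` is coherent. -/
def IsCoherent {Ω : Type u} {mΩ : MeasurableSpace Ω} (μ : Measure[mΩ] Ω) (X Y : Ω → ℝ) : Prop :=
  ∃ 𝒢 ℋ : MeasurableSpace Ω, IsCoherentVia μ 𝒢 ℋ X Y

/-- The values `P(|X - Y| ≥ δ)` over all probability spaces and all pairs `(X, Y)` on them that are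
coherent through two independent sub-σ-fields. -/
def independentFieldsSpread (δ : ℝ) : Set ℝ :=
  {p | ∃ (Ω : Type u) (mΩ : MeasurableSpace Ω) (μ : Measure[mΩ] Ω) (𝒢 ℋ : MeasurableSpace Ω)
    (X Y : Ω → ℝ), IsProbabilityMeasure μ ∧ IsCoherentVia μ 𝒢 ℋ X Y ∧ Indep 𝒢 ℋ μ ∧
      p = μ.real {ω | δ ≤ |X ω - Y ω|}}

/-- The values `P(|X - Y| ≥ δ)` over all probability spaces and all coherent pairs `(X, Y)` on them
such that the random variables `X` and `Y` are independent. -/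
def independentCoherentSpread (δ : ℝ) : Set ℝ :=
  {p | ∃ (Ω : Type u) (mΩ : MeasurableSpace Ω) (μ : Measure[mΩ] Ω) (X Y : Ω → ℝ),
    IsProbabilityMeasure μ ∧ IsCoherent μ X Y ∧ IndepFun X Y μ ∧
      p = μ.real {ω | δ ≤ |X ω - Y ω|}}

/-! Put ε = 1 - δ. If Y - X ≥ δ, then X ≤ ε and Y ≥ δ; call these events B and C, with masses b and
c. Independence evaluates ∫(Y - X) over B ∩ C in terms of P(A ∩ B) and P(A ∩ C), and the common
event A makes this integral small, which bounds the probability by max(b,c)·min(b,c,ε)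
(`measureReal_sub_ge_le`). Adding the mirror bound for X - Y ≥ δ leaves an optimisation over four
masses (`max_mul_min_add_le`). Equality: A = S ∩ T with S, T independent of mass δ, so X = δ·1_S, Y
= δ·1_T. Independent fields make X and Y independent, so one bound and one example settle both
suprema. -/

/-- The elementary optimisation: `a, b` bound the masses of the upper and lower parts of one
variable, `c, d` those of the other. -/
lemma max_mul_min_add_le {ε a b c d : ℝ} (hε0 : 0 ≤ ε) (hε : ε ≤ 1 / 2)
    (ha : 0 ≤ a) (hb : 0 ≤ b) (hc : 0 ≤ c) (hd : 0 ≤ d) (hab : a + b ≤ 1) (hcd : c + d ≤ 1) :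
    max b c * min (min b c) ε + max a d * min (min a d) ε ≤ 2 * ε * (1 - ε) := by
  -- The two maxima belong to different variables. The bound s + t - 2st is nondecreasing in each of
  -- s, t ≤ ε ≤ 1/2, hence maximal at s = t = ε.
  have cross : ∀ {u v x y : ℝ}, 0 ≤ u → 0 ≤ v → 0 ≤ x → 0 ≤ y → u + x ≤ 1 → v + y ≤ 1 →
      x * min v ε + y * min u ε ≤ 2 * ε * (1 - ε) := by
    intro u v x y hu hv hx hy hux hvy
    have h1 : min v ε ≤ v := min_le_left _ _
    have h2 : min u ε ≤ u := min_le_left _ _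
    have h3 : min v ε ≤ ε := min_le_right _ _
    have h4 : min u ε ≤ ε := min_le_right _ _
    have h5 : 0 ≤ min v ε := le_min hv hε0
    have h6 : 0 ≤ min u ε := le_min hu hε0
    generalize min v ε = s at *
    generalize min u ε = t at *
    have e1 : x * s ≤ (1 - t) * s := mul_le_mul_of_nonneg_right (by linarith) h5
    have e2 : y * t ≤ (1 - s) * t := mul_le_mul_of_nonneg_right (by linarith) h6
    have e3 : 0 ≤ (1 - 2 * t) * (ε - s) := mul_nonneg (by linarith) (by linarith)
    have e4 : 0 ≤ (1 - 2 * ε) * (ε - t) := mul_nonneg (by linarith) (by linarith)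
    nlinarith
  -- Both maxima belong to one variable: the sum is at most ε ≤ 2ε(1 - ε).
  have same : ∀ {x y : ℝ} (s t : ℝ), 0 ≤ x → 0 ≤ y → x + y ≤ 1 →
      x * min s ε + y * min t ε ≤ 2 * ε * (1 - ε) := by
    intro x y s t hx hy hxy
    have e1 : x * min s ε ≤ x * ε := mul_le_mul_of_nonneg_left (min_le_right _ _) hx
    have e2 : y * min t ε ≤ y * ε := mul_le_mul_of_nonneg_left (min_le_right _ _) hy
    nlinarith
  rcases le_total b c with h | h <;> rcases le_total a d with h' | h' <;> simp only [h, h',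
    max_eq_left, max_eq_right, min_eq_left, min_eq_right]
  · exact same _ _ hc hd hcd
  · exact cross hd hb hc ha (by linarith) (by linarith)
  · exact cross ha hc hb hd (by linarith) (by linarith)
  · exact same _ _ hb ha (by linarith)

/-- For m = min(b,c) > ε, use m(2ε - m) ≤ ε² and divide by ε; ε = 0 is separate. -/
lemma le_max_mul_min_of_mul_le {ε b c p : ℝ} (hε0 : 0 ≤ ε) (hb : 0 ≤ b) (hc : 0 ≤ c)
    (hpbc : p ≤ b * c) (hp : ε * p ≤ b * c * (2 * ε - min b c)) :
    p ≤ max b c * min (min b c) ε := by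
  have hbc : b * c = max b c * min b c := (max_mul_min b c).symm
  have hM : 0 ≤ max b c := le_max_of_le_left hb
  have hm : 0 ≤ min b c := le_min hb hc
  rw [hbc] at hpbc hp
  generalize max b c = M at *
  generalize min b c = m at *
  rcases le_total m ε with h | h
  · rwa [min_eq_left h]
  · rw [min_eq_right h]
    rcases hε0.eq_or_lt with rfl | hε
    · have h1 : M * m * m = 0 := le_antisymm (by linarith) (by positivity)
      have h2 : M * m = 0 := by
        rcases mul_eq_zero.1 h1 with h | h
        · exact h
        · simp [h]
      linarith
    · refine le_of_mul_le_mul_left ?_ hε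
      nlinarith [mul_nonneg hM (sq_nonneg (m - ε))]

lemma measureReal_sub_ge_le {Ω : Type*} [MeasurableSpace Ω] {μ : Measure Ω}
    [IsProbabilityMeasure μ] {X Y : Ω → ℝ} {A : Set Ω} {δ : ℝ} (hδ1 : δ ≤ 1)
    (hX : Measurable X) (hY : Measurable Y) (hXi : Integrable X μ) (hYi : Integrable Y μ)
    (hX0 : ∀ᵐ ω ∂μ, 0 ≤ X ω) (hY1 : ∀ᵐ ω ∂μ, Y ω ≤ 1) (hXY : IndepFun X Y μ)
    (hXA : ∫ ω in X ⁻¹' Set.Iic (1 - δ), X ω ∂μ = μ.real (A ∩ X ⁻¹' Set.Iic (1 - δ)))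
    (hYA : ∫ ω in Y ⁻¹' Set.Ici δ, Y ω ∂μ = μ.real (A ∩ Y ⁻¹' Set.Ici δ)) :
    μ.real {ω | δ ≤ Y ω - X ω} ≤
      max (μ.real (X ⁻¹' Set.Iic (1 - δ))) (μ.real (Y ⁻¹' Set.Ici δ)) *
        min (min (μ.real (X ⁻¹' Set.Iic (1 - δ))) (μ.real (Y ⁻¹' Set.Ici δ))) (1 - δ) := by
  set B := X ⁻¹' Set.Iic (1 - δ) with hBdef
  set C := Y ⁻¹' Set.Ici δ with hCdef
  set S := {ω | δ ≤ Y ω - X ω} with hSdef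
  have hB : MeasurableSet B := hX measurableSet_Iic
  have hC : MeasurableSet C := hY measurableSet_Ici
  have hS : MeasurableSet S := measurableSet_le measurable_const (hY.sub hX)
  have hind : ∀ s t : Set ℝ, MeasurableSet s → MeasurableSet t →
      μ.real (X ⁻¹' s ∩ Y ⁻¹' t) = μ.real (X ⁻¹' s) * μ.real (Y ⁻¹' t) := fun s t hs ht => by
    simp only [measureReal_def, hXY.measure_inter_preimage_eq_mul s t hs ht, ENNReal.toReal_mul]
  have hBC : μ.real (B ∩ C) = μ.real B * μ.real C := hind _ _ measurableSet_Iic measurableSet_Ici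
  have hBcC : μ.real (Bᶜ ∩ C) = (1 - μ.real B) * μ.real C := by
    have := hind (Set.Iic (1 - δ))ᶜ (Set.Ici δ) measurableSet_Iic.compl measurableSet_Ici
    rwa [Set.preimage_compl, probReal_compl_eq_one_sub hB] at this
  have hSsub : ∀ᵐ ω ∂μ, ω ∈ S → ω ∈ B ∩ C := by
    filter_upwards [hX0, hY1] with ω h0 h1 hω
    simp only [hSdef, Set.mem_ofPred_eq] at hω
    exact ⟨by simp only [hBdef, Set.mem_preimage, Set.mem_Iic]; linarith,
      by simp only [hCdef, Set.mem_preimage, Set.mem_Ici]; linarith⟩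
  have hSae : (B ∩ C ∩ S : Set Ω) =ᵐ[μ] S := by
    filter_upwards [hSsub] with ω hω
    exact propext ⟨fun h => h.2, fun h => ⟨hω h, h⟩⟩
  have hpbc : μ.real S ≤ μ.real B * μ.real C := by
    rw [← hBC, ← measureReal_congr hSae]
    exact measureReal_mono Set.inter_subset_left
  have hYint : ∫ ω in B ∩ C, Y ω ∂μ = μ.real B * μ.real (A ∩ C) := by
    rw [← hYA, ← setIntegral_indicator hC, ← integral_indicator hB, ← integral_indicator hC,
      ← integral_indicator_one hB]
    have := hXY.integral_comp_mul_comp (f := (Set.Iic (1 - δ)).indicator (1 : ℝ → ℝ))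
      (g := (Set.Ici δ).indicator id) hX.aemeasurable hY.aemeasurable
      ((measurable_one.indicator measurableSet_Iic).aestronglyMeasurable)
      ((measurable_id.indicator measurableSet_Ici).aestronglyMeasurable)
    refine Eq.trans (integral_congr_ae (ae_of_all _ fun ω => ?_)) this
    change B.indicator (C.indicator Y) ω = B.indicator 1 ω * C.indicator Y ω
    by_cases h : ω ∈ B <;> simp [h]
  have hXint : ∫ ω in B ∩ C, X ω ∂μ = μ.real (A ∩ B) * μ.real C := by
    rw [← hXA, Set.inter_comm, ← setIntegral_indicator hB, ← integral_indicator hB,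
      ← integral_indicator hC, ← integral_indicator_one hC]
    have := hXY.integral_comp_mul_comp (f := (Set.Iic (1 - δ)).indicator id)
      (g := (Set.Ici δ).indicator (1 : ℝ → ℝ)) hX.aemeasurable hY.aemeasurable
      ((measurable_id.indicator measurableSet_Iic).aestronglyMeasurable)
      ((measurable_one.indicator measurableSet_Ici).aestronglyMeasurable)
    refine Eq.trans (integral_congr_ae (ae_of_all _ fun ω => ?_)) this
    change C.indicator (B.indicator X) ω = B.indicator X ω * C.indicator 1 ω
    by_cases h : ω ∈ C <;> simp [h]
  -- On B ∩ C the difference Y - X is at least 2δ - 1, and at least δ on S, a gain of 1 - δ.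
  have hlow : (2 * δ - 1) * (μ.real B * μ.real C) + (1 - δ) * μ.real S ≤
      μ.real B * μ.real (A ∩ C) - μ.real (A ∩ B) * μ.real C := by
    rw [← hYint, ← hXint, ← integral_sub hYi.integrableOn hXi.integrableOn]
    have h1 : ∫ ω in B ∩ C, ((2 * δ - 1) + S.indicator (fun _ => 1 - δ) ω) ∂μ =
        (2 * δ - 1) * (μ.real B * μ.real C) + (1 - δ) * μ.real S := by
      rw [integral_add (integrable_const _) ((integrable_const _).indicator hS),
        setIntegral_indicator hS, setIntegral_const, setIntegral_const, hBC,
        measureReal_congr hSae, smul_eq_mul, smul_eq_mul]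
      ring
    rw [← h1]
    refine setIntegral_mono_on
      ((integrable_const _).add ((integrable_const _).indicator hS)).integrableOn
      (hYi.sub hXi).integrableOn (hB.inter hC) fun ω hω => ?_
    have h2 : X ω ≤ 1 - δ := hω.1
    have h3 : δ ≤ Y ω := hω.2
    by_cases h : ω ∈ S
    · have h4 : δ ≤ Y ω - X ω := h
      simp only [Set.indicator_of_mem h]
      linarith
    · simp only [Set.indicator_of_notMem h]
      linarith
  have hAC : μ.real (A ∩ C) ≤ μ.real (A ∩ B) + (1 - μ.real B) * μ.real C := by
    rw [← hBcC]
    refine (measureReal_mono fun ω hω => ?_).trans (measureReal_union_le _ _)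
    by_cases h : ω ∈ B
    · exact Or.inl ⟨hω.1, h⟩
    · exact Or.inr ⟨h, hω.2⟩
  have hACle : μ.real (A ∩ C) ≤ μ.real C := measureReal_mono Set.inter_subset_right
  have hAB0 : 0 ≤ μ.real (A ∩ B) := measureReal_nonneg
  have hb : 0 ≤ μ.real B := measureReal_nonneg
  have hc : 0 ≤ μ.real C := measureReal_nonneg
  refine le_max_mul_min_of_mul_le (by linarith) hb hc hpbc ?_
  -- Either way b·P(A ∩ C) - c·P(A ∩ B) ≤ bc(1 - min(b,c)).
  rcases le_total (μ.real B) (μ.real C) with h | h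
  · rw [min_eq_left h]
    nlinarith [mul_le_mul_of_nonneg_left hAC hb, mul_nonneg hAB0 (sub_nonneg.2 h)]
  · rw [min_eq_right h]
    nlinarith [mul_le_mul_of_nonneg_left hAC hc,
      mul_le_mul_of_nonneg_left hACle (sub_nonneg.2 h)]

/-- X and Y are only almost surely conditional expectations; level sets of this version lie in the
sub-σ-field, so averaging over them is exact. -/
lemma exists_eq_condExp_indicator {Ω : Type*} {m mΩ : MeasurableSpace Ω} {μ : Measure Ω}
    [IsProbabilityMeasure μ] (hm : m ≤ mΩ) {A : Set Ω} (hA : MeasurableSet A) :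
    ∃ Z : Ω → ℝ, Z = μ[A.indicator (fun _ => (1 : ℝ)) | m] ∧ Measurable Z ∧ Integrable Z μ ∧
      (∀ᵐ ω ∂μ, 0 ≤ Z ω) ∧ (∀ᵐ ω ∂μ, Z ω ≤ 1) ∧
      ∀ s : Set ℝ, MeasurableSet s → ∫ ω in Z ⁻¹' s, Z ω ∂μ = μ.real (A ∩ Z ⁻¹' s) := by
  have hi : Integrable (A.indicator (fun _ => (1 : ℝ))) μ := (integrable_const _).indicator hA
  refine ⟨_, rfl, (stronglyMeasurable_condExp.mono hm).measurable, integrable_condExp,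
    condExp_nonneg (ae_of_all _ fun ω => Set.indicator_nonneg (fun _ _ => zero_le_one) ω),
    ?_, fun s hs => ?_⟩
  · have := condExp_mono (m := m) hi (integrable_const (1 : ℝ)) (ae_of_all _ fun ω =>
      Set.indicator_le_self' (fun _ _ => zero_le_one) ω)
    rwa [condExp_const hm] at this
  · rw [setIntegral_condExp hm hi (stronglyMeasurable_condExp.measurable hs),
      setIntegral_indicator hA, setIntegral_const, smul_eq_mul, mul_one, Set.inter_comm]

lemma measureReal_abs_sub_ge_le {Ω : Type*} {𝒢 ℋ mΩ : MeasurableSpace Ω} {μ : Measure Ω}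
    [IsProbabilityMeasure μ] {X Y : Ω → ℝ} {δ : ℝ} (hδ : 1 / 2 < δ)
    (hδ1 : δ ≤ 1) (h : IsCoherentVia μ 𝒢 ℋ X Y) (hXY : IndepFun X Y μ) :
    μ.real {ω | δ ≤ |X ω - Y ω|} ≤ 2 * δ * (1 - δ) := by
  obtain ⟨-, -, hG, hH, A, hA, hXA, hYA⟩ := h
  obtain ⟨X', hX', hXm, hXi, hX0, hX1, hXs⟩ := exists_eq_condExp_indicator (μ := μ) hG hA
  obtain ⟨Y', hY', hYm, hYi, hY0, hY1, hYs⟩ := exists_eq_condExp_indicator (μ := μ) hH hA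
  rw [← hX'] at hXA
  rw [← hY'] at hYA
  have hind : IndepFun X' Y' μ := hXY.congr hXA hYA
  have e : μ.real {ω | δ ≤ |X ω - Y ω|} ≤
      μ.real {ω | δ ≤ Y' ω - X' ω} + μ.real {ω | δ ≤ X' ω - Y' ω} := by
    rw [show μ.real {ω | δ ≤ |X ω - Y ω|} = μ.real {ω | δ ≤ |X' ω - Y' ω|} from
      measureReal_congr (by
        filter_upwards [hXA, hYA] with ω h1 h2
        exact congrArg (δ ≤ |·|) (congrArg₂ (· - ·) h1 h2))]
    refine (measureReal_mono fun ω hω => ?_).trans (measureReal_union_le _ _)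
    rcases le_abs.1 (show δ ≤ |X' ω - Y' ω| from hω) with h | h
    · exact Or.inr h
    · exact Or.inl (by simpa using h)
  have e1 := measureReal_sub_ge_le hδ1 hXm hYm hXi hYi hX0 hY1 hind (hXs _ measurableSet_Iic)
    (hYs _ measurableSet_Ici)
  have e2 := measureReal_sub_ge_le hδ1 hYm hXm hYi hXi hY0 hX1 hind.symm
    (hYs _ measurableSet_Iic) (hXs _ measurableSet_Ici)
  have disj : ∀ Z : Ω → ℝ, Measurable Z →
      μ.real (Z ⁻¹' Set.Ici δ) + μ.real (Z ⁻¹' Set.Iic (1 - δ)) ≤ 1 := fun Z hZ => by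
    rw [← measureReal_union _ (hZ measurableSet_Iic)]
    · exact measureReal_le_one
    · refine Disjoint.preimage _ (Set.disjoint_left.2 fun x hx hx' => ?_)
      simp only [Set.mem_Ici, Set.mem_Iic] at hx hx'
      linarith
  have e3 := max_mul_min_add_le (ε := 1 - δ) (by linarith) (by linarith)
    (measureReal_nonneg (μ := μ) (s := X' ⁻¹' Set.Ici δ))
    (measureReal_nonneg (μ := μ) (s := X' ⁻¹' Set.Iic (1 - δ)))
    (measureReal_nonneg (μ := μ) (s := Y' ⁻¹' Set.Ici δ))
    (measureReal_nonneg (μ := μ) (s := Y' ⁻¹' Set.Iic (1 - δ))) (disj X' hXm) (disj Y' hYm)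
  rw [max_comm (μ.real (Y' ⁻¹' Set.Iic (1 - δ))), min_comm (μ.real (Y' ⁻¹' Set.Iic (1 - δ)))] at e2
  linarith

lemma condExp_indicator_inter_of_indep {Ω : Type*} {𝒢 ℋ mΩ : MeasurableSpace Ω} {μ : Measure Ω}
    [IsProbabilityMeasure μ] (hG : 𝒢 ≤ mΩ) (hH : ℋ ≤ mΩ)
    (hind : Indep 𝒢 ℋ μ) {S T : Set Ω} (hS : MeasurableSet[𝒢] S) (hT : MeasurableSet[ℋ] T) :
    S.indicator (fun _ => μ.real T) =ᵐ[μ] μ[(S ∩ T).indicator (fun _ => (1 : ℝ)) | 𝒢] := by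
  have hi : Integrable (T.indicator (fun _ => (1 : ℝ))) μ :=
    (integrable_const _).indicator (hH _ hT)
  have h1 := condExp_indicator (m := 𝒢) hi hS
  have h2 : μ[T.indicator (fun _ => (1 : ℝ)) | 𝒢] =ᵐ[μ] fun _ => _ :=
    condExp_indep_eq hH hG (stronglyMeasurable_const.indicator hT) hind.symm
  rw [Set.indicator_indicator] at h1
  filter_upwards [h1, h2] with ω h1 h2
  rw [h1]
  by_cases h : ω ∈ S
  · simp [h, h2, integral_indicator (hH _ hT)]
  · simp [h]

lemma measureReal_symmDiff_of_indep {Ω : Type*} {mΩ : MeasurableSpace Ω} {μ : Measure Ω}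
    [IsProbabilityMeasure μ] {S T : Set Ω} (hS : MeasurableSet S) (hT : MeasurableSet T)
    {δ : ℝ} (hSδ : μ.real S = δ) (hTδ : μ.real T = δ) (h : IndepSet S T μ) :
    μ.real (symmDiff S T) = 2 * δ * (1 - δ) := by
  have h1 : μ.real (S ∩ T) = δ * δ := by
    rw [measureReal_def, h.measure_inter_eq_mul, ENNReal.toReal_mul, ← measureReal_def,
      ← measureReal_def, hSδ, hTδ]
  have h2 := measureReal_inter_add_sdiff (μ := μ) (s := S) hT
  have h3 := measureReal_inter_add_sdiff (μ := μ) (s := T) hS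
  rw [Set.inter_comm] at h3
  rw [Set.symmDiff_def, measureReal_union disjoint_sdiff_sdiff (hT.diff hS)]
  linarith

lemma mem_independentFieldsSpread {δ : ℝ} (hδ : 0 < δ) (hδ1 : δ ≤ 1) :
    2 * δ * (1 - δ) ∈ independentFieldsSpread.{u} δ := by
  -- A δ-biased coin, tossed twice; `ULift` puts it in the required universe.
  let ν : Measure (ULift.{u} Bool) := ENNReal.ofReal δ • Measure.dirac ⟨true⟩ +
    ENNReal.ofReal (1 - δ) • Measure.dirac ⟨false⟩
  have hν : IsProbabilityMeasure ν := ⟨by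
    simp [ν, ← ENNReal.ofReal_add hδ.le (sub_nonneg.2 hδ1)]⟩
  let E : Set (ULift.{u} Bool) := {⟨true⟩}
  have hE : MeasurableSet E := measurableSet_singleton _
  have hνE : ν.real E = δ := by
    simp [ν, E, measureReal_def, hδ.le]
  let μ := ν.prod ν
  let S : Set (ULift.{u} Bool × ULift.{u} Bool) := Prod.fst ⁻¹' E
  let T : Set (ULift.{u} Bool × ULift.{u} Bool) := Prod.snd ⁻¹' E
  have hS : MeasurableSet S := measurable_fst hE
  have hT : MeasurableSet T := measurable_snd hE
  have hμS : μ.real S = δ := by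
    rw [← hνE, measureReal_def, measurePreserving_fst.measure_preimage hE.nullMeasurableSet,
      measureReal_def]
  have hμT : μ.real T = δ := by
    rw [← hνE, measureReal_def, measurePreserving_snd.measure_preimage hE.nullMeasurableSet,
      measureReal_def]
  have hind : IndepFun Prod.fst Prod.snd μ := indepFun_prod measurable_id measurable_id
  have hindep := (IndepFun_iff_Indep _ _ _).1 hind
  refine ⟨_, inferInstance, μ, MeasurableSpace.comap Prod.fst inferInstance,
    MeasurableSpace.comap Prod.snd inferInstance, S.indicator (fun _ => δ),
    T.indicator (fun _ => δ), inferInstance, ⟨measurable_const.indicator hS,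
      measurable_const.indicator hT, measurable_fst.comap_le, measurable_snd.comap_le, S ∩ T,
      hS.inter hT, ?_, ?_⟩, hindep, ?_⟩
  · have := condExp_indicator_inter_of_indep measurable_fst.comap_le measurable_snd.comap_le
      hindep (S := S) (T := T) ⟨E, hE, rfl⟩ ⟨E, hE, rfl⟩
    rwa [hμT] at this
  · have := condExp_indicator_inter_of_indep measurable_snd.comap_le measurable_fst.comap_le
      hindep.symm (S := T) (T := S) ⟨E, hE, rfl⟩ ⟨E, hE, rfl⟩
    rwa [hμS, Set.inter_comm] at this
  · rw [← measureReal_symmDiff_of_indep hS hT hμS hμT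
      (hindep.indepSet_of_measurableSet ⟨E, hE, rfl⟩ ⟨E, hE, rfl⟩)]
    congr 1
    ext ω
    by_cases h : ω ∈ S <;> by_cases h' : ω ∈ T <;>
      simp [Set.mem_symmDiff, h, h', abs_of_pos hδ, hδ]

lemma independentFieldsSpread_subset (δ : ℝ) :
    independentFieldsSpread.{u} δ ⊆ independentCoherentSpread.{u} δ := by
  rintro p ⟨Ω, mΩ, μ, 𝒢, ℋ, X, Y, hμ, h, hind, rfl⟩
  refine ⟨Ω, mΩ, μ, X, Y, hμ, ⟨𝒢, ℋ, h⟩, ?_, rfl⟩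
  obtain ⟨-, -, -, -, A, -, hXA, hYA⟩ := h
  refine IndepFun.congr ((IndepFun_iff_Indep _ _ _).2 ?_) hXA.symm hYA.symm
  exact indep_of_indep_of_le_left (indep_of_indep_of_le_right hind
    stronglyMeasurable_condExp.measurable.comap_le) stronglyMeasurable_condExp.measurable.comap_le

theorem mainTheorem2 (δ : ℝ) (hδ : 1 / 2 < δ) (hδ1 : δ ≤ 1) :
    IsLUB (independentFieldsSpread.{u} δ) (2 * δ * (1 - δ)) ∧
      IsLUB (independentCoherentSpread.{u} δ) (2 * δ * (1 - δ)) := by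
  have hmem := mem_independentFieldsSpread.{u} (by linarith) hδ1
  have hsub := independentFieldsSpread_subset.{u} δ
  have hub : 2 * δ * (1 - δ) ∈ upperBounds (independentCoherentSpread.{u} δ) := by
    rintro p ⟨Ω, mΩ, μ, X, Y, hμ, ⟨𝒢, ℋ, h⟩, hind, rfl⟩
    exact measureReal_abs_sub_ge_le hδ hδ1 h hind
  exact ⟨IsGreatest.isLUB ⟨hmem, upperBounds_mono_set hsub hub⟩,
    IsGreatest.isLUB ⟨hsub hmem, hub⟩⟩
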